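/- Let $K\subset\mathbb{R}^n$ be a centrally symmetric convex body (a compact convex set with non-empty interior and $K=-K$), and let $r>0$. An ellipsoid is the image of the closed Euclidean unit ball $B_2^n$ under an invertible affine map; $S^{n-1}=\partial B_2^n$, and $\mathrm{vol}_{n-1}$ is $(n-1)$-dimensional (Hausdorff) measure. Assume that $\mathrm{vol}_{n-1}(\partial K\cap\partial\mathcal{E})=0$ for all but finitely many ellipsoids $\mathcal{E}$, that $\mathrm{vol}_{n-1}(\partial K\cap rS^{n-1})=0$, and that $\mathrm{vol}_{n-1}(K\cap rS^{n-1})>0$. Assume further that $K$ is in maximal intersection position of radius $r$, i.e. $\mathrm{vol}_n(K\cap rB_2^n)\ge \mathrm{vol}_n(K\cap\mathcal{E})$ for every ellipsoid $\mathcal{E}$ with $\mathrm{vol}_n(\mathcal{E})=r^n\,\mathrm{vol}_n(B_2^n)$. Let $\sigma$ be the surface area measure on $S^{n-1}$. Then the normalized restriction of $\sigma$ to $S^{n-1}\cap r^{-1}K$, $$\mu(B)=\frac{\sigma(B\cap r^{-1}K)}{\sigma(S^{n-1}\cap r^{-1}K)}\qquad(B\subseteq S^{n-1}\text{ Borel}),$$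 is a well-defined probability measure, and it is isotropic: $$\int_{S^{n-1}}\langle x,\theta\rangle^2\,d\mu(x)=\frac1n\qquad\text{for all }\theta\in S^{n-1}.$$ -/

import Mathlib

open MeasureTheory Metric Set
open scoped Pointwise

/-- A centrally symmetric convex body in `ℝⁿ`: a compact convex set `K` with non-empty interior
and `-K = K`. -/
structure IsSymmConvexBody {n : ℕ} (K : Set (EuclideanSpace ℝ (Fin n))) : Prop where
  convex : Convex ℝ K
  isCompact : IsCompact K
  interior_nonempty : (interior K).Nonempty
  neg_eq : -K = K

/-- An ellipsoid in `ℝⁿ` (solid, non-degenerate, with arbitrary centre): the image of the closed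
Euclidean unit ball under an invertible affine map. -/
def IsEllipsoid {n : ℕ} (ℰ : Set (EuclideanSpace ℝ (Fin n))) : Prop :=
  ∃ f : EuclideanSpace ℝ (Fin n) ≃ᵃ[ℝ] EuclideanSpace ℝ (Fin n), ℰ = f '' closedBall 0 1

/-- `vol_{n-1}` of a subset of `ℝⁿ`, as `(n-1)`-dimensional Hausdorff measure. -/
noncomputable def hypersurfaceVol {n : ℕ} (A : Set (EuclideanSpace ℝ (Fin n))) : ENNReal :=
  Measure.hausdorffMeasure ((n : ℝ) - 1) A

/-- `ℰ` is a maximum intersection ellipsoid of radius `r` for `K`: an ellipsoid of volume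
`rⁿ κₙ`, where `κₙ` is the volume of the unit ball, which maximizes `vol (K ∩ ℰ)` among all
ellipsoids of that volume. -/
def IsMaxIntersectionEllipsoid {n : ℕ} (K : Set (EuclideanSpace ℝ (Fin n))) (r : ℝ)
    (ℰ : Set (EuclideanSpace ℝ (Fin n))) : Prop :=
  (IsEllipsoid ℰ ∧
    volume ℰ = ENNReal.ofReal (r ^ n) * volume (closedBall (0 : EuclideanSpace ℝ (Fin n)) 1)) ∧
  ∀ ℰ' : Set (EuclideanSpace ℝ (Fin n)), IsEllipsoid ℰ' →
    volume ℰ' = ENNReal.ofReal (r ^ n) * volume (closedBall (0 : EuclideanSpace ℝ (Fin n)) 1) →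
    volume (K ∩ ℰ') ≤ volume (K ∩ ℰ)

/-- `K` is in maximal intersection position of radius `r`: the centred ball of radius `r` is a
maximum intersection ellipsoid of radius `r` for `K`. -/
def InMaxIntersectionPosition {n : ℕ} (K : Set (EuclideanSpace ℝ (Fin n))) (r : ℝ) : Prop :=
  IsMaxIntersectionEllipsoid K r (closedBall 0 r)

/-- The surface area measure `σ` on the unit sphere `S^{n-1}`. -/
noncomputable def surfaceMeasure (n : ℕ) : Measure (sphere (0 : EuclideanSpace ℝ (Fin n)) 1) :=
  (volume : Measure (EuclideanSpace ℝ (Fin n))).toSphere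

/-- The normalized restriction `μ_A(B) = σ(B ∩ A ∩ S^{n-1}) / σ(A ∩ S^{n-1})` of the surface area
measure to `A ∩ S^{n-1}`. -/
noncomputable def normalizedSurfaceMeasure {n : ℕ} (A : Set (EuclideanSpace ℝ (Fin n))) :
    Measure (sphere (0 : EuclideanSpace ℝ (Fin n)) 1) :=
  (surfaceMeasure n ((↑) ⁻¹' A))⁻¹ • (surfaceMeasure n).restrict ((↑) ⁻¹' A)

/-- A finite Borel measure `μ` on `S^{n-1}` is isotropic if `∫ ⟨x, θ⟩² dμ(x) = μ(S^{n-1}) / n`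
for all `θ ∈ S^{n-1}`. -/
def IsIsotropic {n : ℕ} (μ : Measure (sphere (0 : EuclideanSpace ℝ (Fin n)) 1)) : Prop :=
  IsFiniteMeasure μ ∧
  ∀ θ : sphere (0 : EuclideanSpace ℝ (Fin n)) 1,
    ∫ x, (inner ℝ (x : EuclideanSpace ℝ (Fin n)) (θ : EuclideanSpace ℝ (Fin n))) ^ 2 ∂μ
      = μ.real univ / n

/-!
The ball `r B` is compared with the ellipsoids obtained by stretching it by `exp (-(n - 1) t)` along
a unit vector `θ` and by `exp t` in the orthogonal directions; in the code these are the sets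
`{x | ‖stretch θ (exp (n t)) x‖ ≤ r exp t}`, and they all have the volume of `r B`.

In polar coordinates, the volume of a set `{N ≤ 1}` with `N` positively homogeneous is
`n⁻¹ ∫ N⁻ⁿ dσ` (`measureReal_le_one_eq_integral_toSphere`). Applied to the intersection of `K` with
a stretched ball, it gives `n⁻¹ ∫ min (ρ_K ^ n) (h t) dσ`, where `ρ_K = (gauge K)⁻¹` is the radial
function of `K` and `h t x`, the `n`-th power of the radial function of the stretched ball, depends
smoothly on `t` and only on `⟪x, θ⟫` (`volume_inter_stretch_eq`). By the extremal property this
integral is maximal at `t = 0`. It may be differentiated there under the integral sign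
(`setIntegral_eq_zero_of_isLocalMax`): where `ρ_K > r` the integrand is locally `h t x`, whose
derivative is `n rⁿ (1 - n ⟪x, θ⟫²)`, and where `ρ_K < r` it is locally constant. Hence
`1 - n ⟪x, θ⟫²` integrates to zero over the directions in `r⁻¹ K`, which is isotropy.

Two facts link Hausdorff measure with the surface measure `σ`. The directions with `ρ_K = r` are
`σ`-null, because the cone over a set of vanishing `(n - 1)`-dimensional measure is Lebesgue null
(`volume_Ioi_smul_eq_zero`): in affine charts of projective space it is covered by smooth images of
products with a null factor. And `σ` charges `r⁻¹ K`, because `K ∩ r S` is not contained in the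
boundary of `K`, so that `r⁻¹ K` contains a non-empty open part of the sphere
(`surfaceMeasure_preimage_ne_zero`).
-/

/-! ### Cones over sets of zero hypersurface measure -/

/-- The coordinates of `a` in the `i`-th affine chart of projective space. They are meaningful only
where `a i ≠ 0`. -/
noncomputable def affineChart {m : ℕ} (i : Fin (m + 1)) (a : EuclideanSpace ℝ (Fin (m + 1))) :
    Fin m → ℝ :=
  fun j => a (i.succAbove j) / a i

theorem lipschitzOnWith_affineChart {m : ℕ} (i : Fin (m + 1)) {R ε : ℝ} (hR : 0 ≤ R)
    (hε : 0 < ε) :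
    LipschitzOnWith (2 * R / ε ^ 2).toNNReal (affineChart i)
      {a : EuclideanSpace ℝ (Fin (m + 1)) | ‖a‖ ≤ R ∧ ε ≤ |a i|} := by
  refine LipschitzOnWith.of_dist_le_mul fun a ha b hb => ?_
  rw [Real.coe_toNNReal _ (by positivity)]
  refine (dist_pi_le_iff (by positivity)).2 fun j => ?_
  have hcoord : ∀ l, |a l - b l| ≤ dist a b := fun l => by
    simpa [dist_eq_norm] using PiLp.norm_apply_le (a - b) l
  have hai : a i ≠ 0 := abs_pos.1 (hε.trans_le ha.2)
  have hbi : b i ≠ 0 := abs_pos.1 (hε.trans_le hb.2)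
  set k := i.succAbove j
  have hkR : |a k| ≤ R := (PiLp.norm_apply_le a k).trans ha.1
  have hiR : |a i| ≤ R := (PiLp.norm_apply_le a i).trans ha.1
  have hnum : |b i * a k - a i * b k| ≤ 2 * R * dist a b := by
    calc |b i * a k - a i * b k| = |a i * (a k - b k) - a k * (a i - b i)| := by ring_nf
      _ ≤ |a i| * |a k - b k| + |a k| * |a i - b i| := by
        simpa only [abs_mul] using abs_sub (a i * (a k - b k)) (a k * (a i - b i))
      _ ≤ R * dist a b + R * dist a b := by gcongr <;> apply hcoord
      _ = 2 * R * dist a b := by ring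
  have hden : ε ^ 2 ≤ |a i * b i| := by
    rw [abs_mul, sq]
    exact mul_le_mul ha.2 hb.2 hε.le (abs_nonneg _)
  have heq : affineChart i a j - affineChart i b j = (b i * a k - a i * b k) / (a i * b i) := by
    simp only [affineChart]
    field_simp
    ring
  rw [Real.dist_eq, heq, abs_div]
  calc |b i * a k - a i * b k| / |a i * b i| ≤ 2 * R * dist a b / ε ^ 2 := by gcongr
    _ = 2 * R / ε ^ 2 * dist a b := by ring

/-- If the chart image of `A` is Lebesgue null, then so is the open cone over `A`: in the
coordinates `(c, z) ↦ (c, c • z)` the cone is contained in a product with a null factor. -/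
theorem volume_Ioi_smul_eq_zero_of_affineChart {m : ℕ} {i : Fin (m + 1)}
    {A : Set (EuclideanSpace ℝ (Fin (m + 1)))} (hA : ∀ a ∈ A, a i ≠ 0)
    (hnull : volume (affineChart i '' A) = 0) : volume (Ioi (0 : ℝ) • A) = 0 := by
  let Φ : ℝ × (Fin m → ℝ) → ℝ × (Fin m → ℝ) := fun p => (p.1, p.1 • p.2)
  have hN : volume ((univ : Set ℝ) ×ˢ (affineChart i '' A)) = 0 := by
    rw [Measure.volume_eq_prod, Measure.prod_prod, hnull, mul_zero]
  have hΦ : volume (Φ '' (univ ×ˢ (affineChart i '' A))) = 0 := by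
    have : (volume : Measure (ℝ × (Fin m → ℝ))).IsAddHaarMeasure :=
      inferInstanceAs (((volume : Measure ℝ).prod (volume : Measure (Fin m → ℝ))).IsAddHaarMeasure)
    refine addHaar_image_eq_zero_of_differentiableOn_of_addHaar_eq_zero volume ?_ hN
    have hΦd : Differentiable ℝ Φ := by fun_prop
    exact hΦd.differentiableOn
  have hmp := (volume_preserving_piFinSuccAbove (fun _ : Fin (m + 1) => ℝ) i).comp
    (PiLp.volume_preserving_ofLp (Fin (m + 1)))
  refine measure_mono_null ?_ (hmp.quasiMeasurePreserving.preimage_null hΦ)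
  rintro _ ⟨ρ, -, a, ha, rfl⟩
  refine ⟨(ρ * a i, affineChart i a), ⟨mem_univ _, a, ha, rfl⟩, ?_⟩
  have := hA a ha
  refine Prod.ext ?_ (funext fun j => ?_)
  · simp [Φ, MeasurableEquiv.piFinSuccAbove, Fin.insertNthEquiv]
  · simp [Φ, MeasurableEquiv.piFinSuccAbove, Fin.insertNthEquiv, affineChart, Fin.removeNth]
    field_simp

/-- The open cone over a set of zero `(n - 1)`-dimensional measure is Lebesgue null. -/
theorem volume_Ioi_smul_eq_zero {m : ℕ} {A : Set (EuclideanSpace ℝ (Fin (m + 1)))}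
    (h0 : (0 : EuclideanSpace ℝ (Fin (m + 1))) ∉ A) (hA : hypersurfaceVol A = 0) :
    volume (Ioi (0 : ℝ) • A) = 0 := by
  have hA' : Measure.hausdorffMeasure (m : ℝ) A = 0 := by
    simpa [hypersurfaceVol] using hA
  -- `affineChart i` is Lipschitz only where `a` is bounded and `a i` is bounded away from `0`;
  -- countably many such regions cover `A`.
  let B : Fin (m + 1) × ℕ → Set (EuclideanSpace ℝ (Fin (m + 1))) := fun p =>
    A ∩ {a | ‖a‖ ≤ (p.2 + 1 : ℝ) ∧ ((p.2 : ℝ) + 1)⁻¹ ≤ |a p.1|}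
  have hcover : A ⊆ ⋃ p, B p := by
    intro a ha
    obtain ⟨i, hi⟩ : ∃ i, a i ≠ 0 := by
      by_contra! h
      exact h0 ((show a = 0 from PiLp.ext h) ▸ ha)
    obtain ⟨k, hk⟩ := exists_nat_ge (max ‖a‖ |a i|⁻¹)
    refine mem_iUnion.2 ⟨(i, k), ha, ?_, ?_⟩
    · linarith [le_max_left ‖a‖ |a i|⁻¹]
    · rw [inv_le_comm₀ (by positivity) (abs_pos.2 hi)]
      linarith [le_max_right ‖a‖ |a i|⁻¹]
  refine measure_mono_null (smul_subset_smul_left hcover) ?_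
  rw [smul_iUnion]
  refine measure_iUnion_null fun p => ?_
  have hpos : (0 : ℝ) < ((p.2 : ℝ) + 1)⁻¹ := by positivity
  refine volume_Ioi_smul_eq_zero_of_affineChart (i := p.1)
    (fun a ha => abs_pos.1 (hpos.trans_le ha.2.2)) ?_
  have hle := ((lipschitzOnWith_affineChart p.1 (by positivity : (0 : ℝ) ≤ p.2 + 1) hpos).mono
    (inter_subset_right (s := A))).hausdorffMeasure_image_le (d := m) (by positivity)
  have hvol : (Measure.hausdorffMeasure (m : ℝ) : Measure (Fin m → ℝ)) = volume := by
    simpa using hausdorffMeasure_pi_real (ι := Fin m)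
  rw [hvol, measure_mono_null inter_subset_left hA', mul_zero] at hle
  exact nonpos_iff_eq_zero.1 hle

/-! ### Volume in polar coordinates -/

/-- The closed counterpart of `MeasureTheory.Measure.volumeIoiPow_apply_Iio`. -/
theorem volumeIoiPow_Iic (k : ℕ) (x : Ioi (0 : ℝ)) :
    Measure.volumeIoiPow k (Iic x) = ENNReal.ofReal (x.1 ^ (k + 1) / (k + 1)) := by
  rw [← Measure.volumeIoiPow_apply_Iio]
  have hx : Measure.volumeIoiPow k {x} = 0 := by
    refine withDensity_absolutelyContinuous _ _ ?_
    rw [comap_subtype_coe_apply measurableSet_Ioi]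
    simp
  rw [← Iio_union_right]
  refine le_antisymm ((measure_union_le _ _).trans ?_) (measure_mono subset_union_left)
  rw [hx, add_zero]

/-- The volume of the sublevel set `{N ≤ 1}` of a positively homogeneous function, in polar
coordinates. -/
theorem measureReal_le_one_eq_integral_toSphere {E : Type*} [NormedAddCommGroup E]
    [NormedSpace ℝ E] [MeasurableSpace E] [BorelSpace E] [FiniteDimensional ℝ E] [Nontrivial E]
    (μ : Measure E) [μ.IsAddHaarMeasure] {N : E → ℝ} (hN : Continuous N)
    (hsmul : ∀ t : ℝ, 0 < t → ∀ x, N (t • x) = t * N x) (hpos : ∀ x, x ≠ 0 → 0 < N x) :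
    μ.real {x | N x ≤ 1} =
      (Module.finrank ℝ E : ℝ)⁻¹ * ∫ θ : sphere (0 : E) 1, (N θ)⁻¹ ^ Module.finrank ℝ E
        ∂μ.toSphere := by
  set d := Module.finrank ℝ E with hd
  have hd0 : 0 < d := Module.finrank_pos
  have hNpos : ∀ θ : sphere (0 : E) 1, 0 < N θ := fun θ => hpos _ (ne_of_mem_sphere θ.2 one_ne_zero)
  have key : μ {x | N x ≤ 1} =
      ∫⁻ θ : sphere (0 : E) 1, ENNReal.ofReal ((d : ℝ)⁻¹ * (N θ)⁻¹ ^ d) ∂μ.toSphere := by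
    let S : Set (sphere (0 : E) 1 × Ioi (0 : ℝ)) := {p | N (p.2.1 • p.1.1) ≤ 1}
    have hS : MeasurableSet S :=
      measurableSet_le (hN.comp (by fun_prop)).measurable measurable_const
    have h1 : μ {x | N x ≤ 1} = μ.comap ((↑) : ({0}ᶜ : Set E) → E) ((↑) ⁻¹' {x | N x ≤ 1}) := by
      rw [comap_subtype_coe_apply (measurableSet_singleton _).compl, Subtype.image_preimage_coe,
        inter_comm, ← sdiff_eq, measure_sdiff_null (measure_singleton _)]
    have h2 : ((↑) ⁻¹' {x | N x ≤ 1} : Set ({0}ᶜ : Set E)) = homeomorphUnitSphereProd E ⁻¹' S := by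
      ext x
      have hx : ‖(x : E)‖ ≠ 0 := norm_ne_zero_iff.2 x.2
      simp [S, smul_smul, hx]
    rw [h1, h2, μ.measurePreserving_homeomorphUnitSphereProd.measure_preimage
      hS.nullMeasurableSet, Measure.prod_apply hS]
    refine lintegral_congr fun θ => ?_
    have h3 : Prod.mk θ ⁻¹' S = Iic (⟨(N θ)⁻¹, inv_pos.2 (hNpos θ)⟩ : Ioi (0 : ℝ)) := by
      ext ρ
      simp only [S, mem_preimage, mem_ofPred_eq, mem_Iic, ← Subtype.coe_le_coe]
      rw [hsmul _ ρ.2, le_inv_comm₀ ρ.2 (hNpos θ), ← one_div, le_div_iff₀' ρ.2]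
    rw [h3, volumeIoiPow_Iic, ← hd, Nat.sub_add_cancel hd0, Nat.cast_pred hd0, sub_add_cancel,
      div_eq_inv_mul]
  rw [measureReal_def, key, ← integral_const_mul, integral_eq_lintegral_of_nonneg_ae]
  · exact .of_forall fun θ => by have := hNpos θ; positivity
  · exact (((hN.measurable.comp measurable_subtype_coe).inv.pow_const d).const_mul
      _).aestronglyMeasurable

/-! ### Volume-preserving stretches of the ball -/

/-- The dilation by the factor `c` along the unit vector `θ` that fixes the orthogonal complement of
`θ`. It is written as a transvection, whose determinant is known. -/
noncomputable def stretch {n : ℕ} (θ : EuclideanSpace ℝ (Fin n)) (c : ℝ) :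
    EuclideanSpace ℝ (Fin n) →ₗ[ℝ] EuclideanSpace ℝ (Fin n) :=
  LinearMap.transvection ((c - 1) • (innerₛₗ ℝ θ)) θ

theorem stretch_apply {n : ℕ} (θ x : EuclideanSpace ℝ (Fin n)) (c : ℝ) :
    stretch θ c x = x + ((c - 1) * inner ℝ x θ) • θ := by
  simp [stretch, LinearMap.transvection.apply, real_inner_comm]

theorem det_stretch {n : ℕ} {θ : EuclideanSpace ℝ (Fin n)} (hθ : ‖θ‖ = 1) (c : ℝ) :
    LinearMap.det (stretch θ c) = c := by
  rw [stretch, LinearMap.transvection.det]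
  simp [hθ]

theorem norm_stretch_sq {n : ℕ} {θ : EuclideanSpace ℝ (Fin n)} (hθ : ‖θ‖ = 1) (c : ℝ)
    (x : EuclideanSpace ℝ (Fin n)) :
    ‖stretch θ c x‖ ^ 2 = ‖x‖ ^ 2 + (c ^ 2 - 1) * (inner ℝ x θ) ^ 2 := by
  rw [stretch_apply, norm_add_sq_real, norm_smul, inner_smul_right, hθ, mul_one, Real.norm_eq_abs,
    sq_abs]
  ring

theorem isEllipsoid_norm_stretch_le {n : ℕ} {θ : EuclideanSpace ℝ (Fin n)} (hθ : ‖θ‖ = 1)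
    {c ρ : ℝ} (hc : 0 < c) (hρ : 0 < ρ) : IsEllipsoid {x | ‖stretch θ c x‖ ≤ ρ} := by
  have hdet : IsUnit (LinearMap.det (stretch θ c)) := by
    rw [det_stretch hθ]; exact hc.ne'.isUnit
  let e := (stretch θ c).equivOfIsUnitDet hdet
  let g := (LinearEquiv.smulOfNeZero ℝ (EuclideanSpace ℝ (Fin n)) ρ hρ.ne').trans e.symm
  refine ⟨g.toAffineEquiv, ?_⟩
  have hg : ⇑g.toAffineEquiv = ⇑g := rfl
  rw [hg, LinearEquiv.image_eq_preimage_symm]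
  ext x
  have : g.symm x = ρ⁻¹ • stretch θ c x := by
    rw [LinearEquiv.symm_apply_eq]
    change x = e.symm (ρ • ρ⁻¹ • stretch θ c x)
    rw [smul_inv_smul₀ hρ.ne', LinearEquiv.eq_symm_apply]
    simp [e]
  simp only [mem_ofPred_eq, mem_preimage, mem_closedBall_zero_iff]
  rw [this, norm_smul, norm_inv, Real.norm_of_nonneg hρ.le, inv_mul_le_iff₀ hρ, mul_one]

theorem volume_norm_stretch_le {n : ℕ} {θ : EuclideanSpace ℝ (Fin n)} (hθ : ‖θ‖ = 1)
    {c ρ r : ℝ} (hc : 0 < c) (hρ : 0 < ρ) (h : ρ ^ n = c * r ^ n) :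
    volume {x | ‖stretch θ c x‖ ≤ ρ} =
      ENNReal.ofReal (r ^ n) * volume (closedBall (0 : EuclideanSpace ℝ (Fin n)) 1) := by
  have hset : {x | ‖stretch θ c x‖ ≤ ρ} = stretch θ c ⁻¹' closedBall 0 ρ := by
    ext x; simp
  rw [hset, Measure.addHaar_preimage_linearMap _ (by rw [det_stretch hθ]; exact hc.ne'),
    det_stretch hθ, Measure.addHaar_closedBall' _ _ hρ.le, ← mul_assoc,
    ← ENNReal.ofReal_mul (abs_nonneg _), finrank_euclideanSpace_fin, h,
    abs_of_pos (inv_pos.2 hc), inv_mul_cancel_left₀ hc.ne']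

/-! ### Differentiating the integral of a truncated family -/

/-- If the truncated integral `t ↦ ∫ min (c x) (h t x)` has a local maximum at `t = 0`, then the
derivative of `h` integrates to zero over the region where the truncation is inactive. The integrand
need not be differentiable where `h 0 x = c x`, so this set has to be null. -/
theorem setIntegral_eq_zero_of_isLocalMax {X : Type*} [MeasurableSpace X] {μ : Measure X}
    [IsFiniteMeasure μ] {c : X → ℝ} {h : ℝ → X → ℝ} {h' : X → ℝ} {C : NNReal} {M : ℝ}
    (hc : Measurable c) (hmeas : ∀ t, Measurable (h t)) (h'meas : Measurable h')
    (hc0 : ∀ x, 0 ≤ c x) (hbdd : ∀ x, |h 0 x| ≤ M)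
    (hlip : ∀ x, LipschitzOnWith C (fun t => h t x) (Icc (-1) 1))
    (hderiv : ∀ x, HasDerivAt (fun t => h t x) (h' x) 0)
    (hne : ∀ᵐ x ∂μ, h 0 x ≠ c x)
    (hmax : IsLocalMax (fun t => ∫ x, min (c x) (h t x) ∂μ) 0) :
    ∫ x in {x | h 0 x ≤ c x}, h' x ∂μ = 0 := by
  have hS : MeasurableSet {x | h 0 x ≤ c x} := measurableSet_le (hmeas 0) hc
  have key := hasDerivAt_integral_of_dominated_loc_of_lip (μ := μ) (𝕜 := ℝ)
    (F := fun t x => min (c x) (h t x)) (x₀ := (0 : ℝ)) (bound := fun _ => (C : ℝ))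
    (F' := {x | h 0 x ≤ c x}.indicator h') (s := Icc (-1) 1)
    (Icc_mem_nhds (by norm_num) (by norm_num))
    (.of_forall fun t => (hc.min (hmeas t)).aestronglyMeasurable) ?_
    (h'meas.indicator hS).aestronglyMeasurable ?_ (integrable_const _) ?_
  · rw [← integral_indicator hS]
    exact hmax.hasDerivAt_eq_zero key.2
  · refine Integrable.of_bound (hc.min (hmeas 0)).aestronglyMeasurable M (.of_forall fun x => ?_)
    have hb := abs_le.1 (hbdd x)
    have hM : 0 ≤ M := (abs_nonneg _).trans (hbdd x)
    rw [Real.norm_eq_abs, abs_le]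
    exact ⟨le_min (by linarith [hc0 x]) hb.1, (min_le_right _ _).trans hb.2⟩
  · refine .of_forall fun x => LipschitzOnWith.of_dist_le_mul fun s hs t ht => ?_
    have h1 := (hlip x).dist_le_mul s hs t ht
    have h2 := abs_min_sub_min_le_max (c x) (h s x) (c x) (h t x)
    simp only [sub_self, abs_zero, abs_nonneg, sup_of_le_right, Real.dist_eq] at h1 h2 ⊢
    simpa using h2.trans h1
  · filter_upwards [hne] with x hx
    have hcont := (hderiv x).continuousAt
    rcases lt_or_gt_of_ne hx with hlt | hgt
    · rw [indicator_of_mem (show x ∈ {x | h 0 x ≤ c x} from hlt.le)]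
      refine (hderiv x).congr_of_eventuallyEq ?_
      filter_upwards [hcont.eventually_lt continuousAt_const hlt] with t ht
      exact min_eq_right ht.le
    · rw [indicator_of_notMem (show x ∉ {x | h 0 x ≤ c x} from hgt.not_ge)]
      refine (hasDerivAt_const (0 : ℝ) (c x)).congr_of_eventuallyEq ?_
      filter_upwards [continuousAt_const.eventually_lt hcont hgt] with t ht
      exact min_eq_left ht.le

/-- A jointly `C¹` family is equi-Lipschitz in the first variable over compact sets. -/
theorem exists_lipschitzOnWith_of_contDiffAt {G : ℝ × ℝ → ℝ} {s u : Set ℝ} (hs : IsCompact s)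
    (hu : IsCompact u) (hG : ∀ p ∈ s ×ˢ u, ContDiffAt ℝ 1 G p) :
    ∃ C, ∀ y ∈ u, LipschitzOnWith C (fun t => G (t, y)) s := by
  have hloc : LocallyLipschitzOn (s ×ˢ u) G := fun p hp => by
    obtain ⟨K, t, ht, hK⟩ := (hG p hp).exists_lipschitzOnWith
    exact ⟨K, t, mem_nhdsWithin_of_mem_nhds ht, hK⟩
  obtain ⟨C, hC⟩ := hloc.exists_lipschitzOnWith_of_compact (hs.prod hu)
  refine ⟨C, fun y hyu => ?_⟩
  have hy : LipschitzOnWith 1 (fun t : ℝ => (t, y)) s :=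
    (LipschitzWith.prodMk_right y).lipschitzOnWith
  simpa using! hC.comp hy fun t ht => ⟨ht, hyu⟩

/-! ### The radial function of the stretched ball -/

/-- The `n`-th power of the radial function of the ellipsoid `{x | ‖stretch θ eⁿᵗ x‖ ≤ r eᵗ}`, at
the time `p.1` and in a unit direction `x` with `⟪x, θ⟫ = p.2`. -/
noncomputable def radialPow (n : ℕ) (r : ℝ) (p : ℝ × ℝ) : ℝ :=
  (r * Real.exp p.1 / √(1 + (Real.exp (n * p.1) ^ 2 - 1) * p.2 ^ 2)) ^ n

theorem one_add_mul_sq_pos {c u : ℝ} (hc : 0 < c) (hu : u ∈ Icc (-1 : ℝ) 1) :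
    0 < 1 + (c ^ 2 - 1) * u ^ 2 := by
  have h1 : u ^ 2 ≤ 1 := (sq_le_one_iff_abs_le_one u).2 (abs_le.2 hu)
  rcases eq_or_ne u 0 with rfl | h0
  · simp
  · have : 0 < c ^ 2 * u ^ 2 := by positivity
    nlinarith

theorem contDiffAt_radialPow (n : ℕ) (r : ℝ) {p : ℝ × ℝ} (hp : p.2 ∈ Icc (-1 : ℝ) 1) :
    ContDiffAt ℝ 1 (radialPow n r) p := by
  have hpos := one_add_mul_sq_pos (Real.exp_pos (n * p.1)) hp
  have hq : ContDiffAt ℝ 1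
      (fun p : ℝ × ℝ => 1 + (Real.exp (n * p.1) ^ 2 - 1) * p.2 ^ 2) p := by fun_prop
  have hr : ContDiffAt ℝ 1 (fun p : ℝ × ℝ => r * Real.exp p.1) p := by fun_prop
  exact (hr.div (hq.sqrt hpos.ne') (Real.sqrt_pos.2 hpos).ne').pow n

theorem hasDerivAt_radialPow (n : ℕ) (r u : ℝ) :
    HasDerivAt (fun t => radialPow n r (t, u)) (n * r ^ n * (1 - n * u ^ 2)) 0 := by
  have h1 : HasDerivAt (fun t : ℝ => Real.exp (n * t)) n 0 := by
    simpa using ((hasDerivAt_id (0 : ℝ)).const_mul (n : ℝ)).exp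
  have hq : HasDerivAt (fun t : ℝ => 1 + (Real.exp (n * t) ^ 2 - 1) * u ^ 2)
      (2 * n * u ^ 2) 0 := by
    simpa using (((h1.pow 2).sub_const 1).mul_const (u ^ 2)).const_add 1
  have hr : HasDerivAt (fun t : ℝ => r * Real.exp t) r 0 := by
    simpa using (Real.hasDerivAt_exp 0).const_mul r
  have := (hr.div (hq.sqrt (by simp)) (by simp)).pow n
  refine this.congr_deriv ?_
  rcases n with _ | n
  · simp
  · simp
    ring

theorem radialPow_zero (n : ℕ) (r u : ℝ) : radialPow n r (0, u) = r ^ n := by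
  simp [radialPow]

theorem measurable_radialPow (n : ℕ) (r : ℝ) : Measurable (radialPow n r) := by
  unfold radialPow
  fun_prop

theorem inv_max_pow {a b : ℝ} (ha : 0 < a) (hb : 0 < b) (n : ℕ) :
    (max a b)⁻¹ ^ n = min (a⁻¹ ^ n) (b⁻¹ ^ n) := by
  rcases le_total a b with h | h
  · rw [max_eq_right h, min_eq_right (by gcongr)]
  · rw [max_eq_left h, min_eq_left (by gcongr)]

/-! ### First-order condition for the ball and isotropy -/

theorem IsSymmConvexBody.mem_nhds_zero {n : ℕ} {K : Set (EuclideanSpace ℝ (Fin n))}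
    (hK : IsSymmConvexBody K) : K ∈ nhds 0 := by
  obtain ⟨x, hx⟩ := hK.interior_nonempty
  have hneg : -x ∈ interior K := by
    have hpre : Neg.neg ⁻¹' interior K = interior K :=
      ((Homeomorph.neg _).preimage_interior K).trans (congrArg interior hK.neg_eq)
    exact hpre.symm.subset hx
  have h := hK.convex.interior hx hneg (by norm_num : (0 : ℝ) ≤ 1 / 2)
    (by norm_num : (0 : ℝ) ≤ 1 / 2) (by norm_num)
  simpa [mem_interior_iff_mem_nhds] using h

theorem inner_mem_Icc {n : ℕ} (x θ : sphere (0 : EuclideanSpace ℝ (Fin n)) 1) :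
    inner ℝ (x : EuclideanSpace ℝ (Fin n)) (θ : EuclideanSpace ℝ (Fin n)) ∈ Icc (-1 : ℝ) 1 := by
  have := abs_real_inner_le_norm (x : EuclideanSpace ℝ (Fin n)) θ
  rw [norm_eq_of_mem_sphere, norm_eq_of_mem_sphere, mul_one] at this
  exact abs_le.1 this

/-- The volume of the intersection of `K` with a stretched ball, in polar coordinates: the radial
function of an intersection is the minimum of the radial functions. -/
theorem volume_inter_stretch_eq {n : ℕ} {K : Set (EuclideanSpace ℝ (Fin n))}
    (hK : IsSymmConvexBody K) {r : ℝ} (hr : 0 < r)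
    (θ : sphere (0 : EuclideanSpace ℝ (Fin n)) 1) (t : ℝ) :
    volume.real (K ∩ {x | ‖stretch (θ : EuclideanSpace ℝ (Fin n)) (Real.exp (n * t)) x‖
        ≤ r * Real.exp t}) =
      (n : ℝ)⁻¹ * ∫ x : sphere (0 : EuclideanSpace ℝ (Fin n)) 1,
        min ((gauge K x)⁻¹ ^ n) (radialPow n r (t, inner ℝ (x : EuclideanSpace ℝ (Fin n)) θ))
          ∂surfaceMeasure n := by
  have hθ : ‖(θ : EuclideanSpace ℝ (Fin n))‖ = 1 := norm_eq_of_mem_sphere θ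
  have : Nontrivial (EuclideanSpace ℝ (Fin n)) := ⟨⟨θ, 0, ne_of_mem_sphere θ.2 one_ne_zero⟩⟩
  have hnhds := hK.mem_nhds_zero
  have hρ : 0 < r * Real.exp t := by positivity
  set S := stretch (θ : EuclideanSpace ℝ (Fin n)) (Real.exp (n * t)) with hS
  have hgauge : ∀ x, x ≠ 0 → 0 < gauge K x := fun x hx =>
    (gauge_pos (absorbent_nhds_zero hnhds)
      ((NormedSpace.isVonNBounded_iff ℝ).2 hK.isCompact.isBounded)).2 hx
  have hset : K ∩ {x | ‖S x‖ ≤ r * Real.exp t} =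
      {x | max (gauge K x) (‖S x‖ / (r * Real.exp t)) ≤ 1} := by
    ext x
    simp only [mem_inter_iff, mem_ofPred_eq, max_le_iff, div_le_one hρ,
      gauge_le_one_iff_mem_closure hK.convex hnhds, hK.isCompact.isClosed.closure_eq]
  have hcont : Continuous fun x => max (gauge K x) (‖S x‖ / (r * Real.exp t)) :=
    (continuous_gauge hK.convex hnhds).max
      ((LinearMap.continuous_of_finiteDimensional S).norm.div_const _)
  rw [hset, measureReal_le_one_eq_integral_toSphere volume hcont, finrank_euclideanSpace_fin]
  · congr 1
    refine integral_congr_ae (.of_forall fun x => ?_)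
    have hx : ‖(x : EuclideanSpace ℝ (Fin n))‖ = 1 := norm_eq_of_mem_sphere x
    have hq := one_add_mul_sq_pos (Real.exp_pos (n * t)) (inner_mem_Icc x θ)
    have hSx : ‖S x‖ = √(1 + (Real.exp (n * t) ^ 2 - 1) *
        inner ℝ (x : EuclideanSpace ℝ (Fin n)) θ ^ 2) := by
      rw [eq_comm, Real.sqrt_eq_iff_eq_sq hq.le (norm_nonneg _), hS, norm_stretch_sq hθ, hx,
        one_pow]
    have hSpos : 0 < ‖S x‖ := hSx ▸ Real.sqrt_pos.2 hq
    change (max (gauge K x) (‖S x‖ / (r * Real.exp t)))⁻¹ ^ n = _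
    rw [inv_max_pow (hgauge _ (ne_of_mem_sphere x.2 one_ne_zero)) (by positivity), inv_div, hSx]
    rfl
  · intro s hs x
    rw [gauge_smul_of_nonneg hs.le, map_smul, norm_smul, Real.norm_of_nonneg hs.le,
      smul_eq_mul, mul_div_assoc, mul_max_of_nonneg _ _ hs.le]
  · exact fun x hx => lt_max_of_lt_left (hgauge x hx)

/-- Directions in which the boundary of `K` lies at distance exactly `r` are negligible. -/
theorem ae_smul_notMem_frontier {n : ℕ} (hn : n ≠ 0) {K : Set (EuclideanSpace ℝ (Fin n))}
    {r : ℝ} (hr : 0 < r) (hnull : hypersurfaceVol (frontier K ∩ sphere 0 r) = 0) :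
    ∀ᵐ x : sphere (0 : EuclideanSpace ℝ (Fin n)) 1 ∂surfaceMeasure n,
      r • (x : EuclideanSpace ℝ (Fin n)) ∉ frontier K := by
  obtain ⟨m, rfl⟩ := Nat.exists_eq_succ_of_ne_zero hn
  have hcone := volume_Ioi_smul_eq_zero (A := frontier K ∩ sphere 0 r)
    (fun h => ne_of_mem_sphere h.2 hr.ne' rfl) hnull
  have hmeas : MeasurableSet {x : sphere (0 : EuclideanSpace ℝ (Fin (m + 1))) 1 |
      r • (x : EuclideanSpace ℝ (Fin (m + 1))) ∈ frontier K} :=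
    (isClosed_frontier.preimage (by fun_prop)).measurableSet
  have hsub : Ioo (0 : ℝ) 1 • (((↑) : sphere (0 : EuclideanSpace ℝ (Fin (m + 1))) 1 → _) ''
      {x | r • (x : EuclideanSpace ℝ (Fin (m + 1))) ∈ frontier K}) ⊆
      Ioi (0 : ℝ) • (frontier K ∩ sphere 0 r) := by
    rintro _ ⟨ρ, hρ, _, ⟨x, hx, rfl⟩, rfl⟩
    refine ⟨ρ * r⁻¹, mul_pos hρ.1 (inv_pos.2 hr), r • (x : EuclideanSpace ℝ (Fin (m + 1))),
      ⟨hx, ?_⟩, ?_⟩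
    · simp [norm_smul, abs_of_pos hr]
    · simp [smul_smul, hr.ne']
  rw [ae_iff]
  simp only [not_not]
  rw [surfaceMeasure, Measure.toSphere_apply' _ hmeas, measure_mono_null hsub hcone, mul_zero]

/-- The part of the unit sphere inside `r⁻¹ • K` has positive area: otherwise no interior point of
`K` lies on the sphere of radius `r`, which makes `K ∩ sphere 0 r` a null set. -/
theorem surfaceMeasure_preimage_ne_zero {n : ℕ} {K : Set (EuclideanSpace ℝ (Fin n))}
    {r : ℝ} (hr : 0 < r) (hnull : hypersurfaceVol (frontier K ∩ sphere 0 r) = 0)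
    (hpos : 0 < hypersurfaceVol (K ∩ sphere 0 r)) :
    surfaceMeasure n ((↑) ⁻¹' (r⁻¹ • K)) ≠ 0 := by
  intro h0
  have hopen : IsOpen {x : sphere (0 : EuclideanSpace ℝ (Fin n)) 1 |
      r • (x : EuclideanSpace ℝ (Fin n)) ∈ interior K} :=
    isOpen_interior.preimage (by fun_prop)
  have hempty : {x : sphere (0 : EuclideanSpace ℝ (Fin n)) 1 |
      r • (x : EuclideanSpace ℝ (Fin n)) ∈ interior K} = ∅ := by
    refine hopen.eq_empty_of_measure_zero (μ := volume.toSphere) (measure_mono_null ?_ h0)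
    intro x hx
    exact (mem_inv_smul_set_iff₀ hr.ne' _ _).2 (interior_subset hx)
  suffices hsub : K ∩ sphere 0 r ⊆ frontier K ∩ sphere 0 r from
    hpos.ne' (measure_mono_null hsub hnull)
  refine fun y hy => ⟨⟨subset_closure hy.1, fun hyi => ?_⟩, hy.2⟩
  have hy : ‖y‖ = r := by simpa using hy.2
  have : (⟨r⁻¹ • y, by simp [norm_smul, hy, abs_of_pos hr, hr.ne']⟩ :
      sphere (0 : EuclideanSpace ℝ (Fin n)) 1) ∈ {x : sphere (0 : EuclideanSpace ℝ (Fin n)) 1 |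
      r • (x : EuclideanSpace ℝ (Fin n)) ∈ interior K} := by
    simpa [smul_smul, hr.ne'] using hyi
  rw [hempty] at this
  exact this

/-- The first-order condition for the maximality of the ball among the stretched balls. -/
theorem setIntegral_one_sub_inner_sq_eq_zero {n : ℕ} (hn : n ≠ 0)
    {K : Set (EuclideanSpace ℝ (Fin n))}
    (hK : IsSymmConvexBody K) {r : ℝ} (hr : 0 < r)
    (hnull : hypersurfaceVol (frontier K ∩ sphere 0 r) = 0) (hmax : InMaxIntersectionPosition K r)
    (θ : sphere (0 : EuclideanSpace ℝ (Fin n)) 1) :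
    ∫ x in ((↑) : sphere (0 : EuclideanSpace ℝ (Fin n)) 1 → _) ⁻¹' (r⁻¹ • K),
      (1 - (n : ℝ) * inner ℝ (x : EuclideanSpace ℝ (Fin n)) θ ^ 2)
        ∂surfaceMeasure n = 0 := by
  have hθ : ‖(θ : EuclideanSpace ℝ (Fin n))‖ = 1 := norm_eq_of_mem_sphere θ
  have hnhds := hK.mem_nhds_zero
  have hgc : Continuous (gauge K) := continuous_gauge hK.convex hnhds
  have hgpos : ∀ x : sphere (0 : EuclideanSpace ℝ (Fin n)) 1, 0 < gauge K x := fun x =>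
    (gauge_pos (absorbent_nhds_zero hnhds)
      ((NormedSpace.isVonNBounded_iff ℝ).2 hK.isCompact.isBounded)).2
      (ne_of_mem_sphere x.2 one_ne_zero)
  have hgr : ∀ x : sphere (0 : EuclideanSpace ℝ (Fin n)) 1,
      gauge K (r • (x : EuclideanSpace ℝ (Fin n))) = r * gauge K x := fun x => by
    rw [gauge_smul_of_nonneg hr.le, smul_eq_mul]
  have : IsFiniteMeasure (surfaceMeasure n) := by unfold surfaceMeasure; infer_instance
  have hmeasInner : Measurable fun x : sphere (0 : EuclideanSpace ℝ (Fin n)) 1 =>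
      inner ℝ (x : EuclideanSpace ℝ (Fin n)) (θ : EuclideanSpace ℝ (Fin n)) :=
    (by fun_prop : Continuous _).measurable
  obtain ⟨C, hC⟩ := exists_lipschitzOnWith_of_contDiffAt (G := radialPow n r)
    (isCompact_Icc (a := (-1 : ℝ)) (b := 1)) (isCompact_Icc (a := (-1 : ℝ)) (b := 1))
    (fun p hp => contDiffAt_radialPow n r hp.2)
  have key := setIntegral_eq_zero_of_isLocalMax (μ := surfaceMeasure n) (C := C) (M := r ^ n)
    (c := fun x => (gauge K x)⁻¹ ^ n)
    (h := fun t x => radialPow n r (t, inner ℝ (x : EuclideanSpace ℝ (Fin n)) θ))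
    (h' := fun x => n * r ^ n * (1 - n * inner ℝ (x : EuclideanSpace ℝ (Fin n)) θ ^ 2))
    ((hgc.measurable.comp measurable_subtype_coe).inv.pow_const n)
    (fun t => (measurable_radialPow n r).comp (measurable_const.prodMk hmeasInner))
    (by fun_prop)
    (fun x => by have := hgpos x; positivity)
    (fun x => by rw [radialPow_zero, abs_of_pos (by positivity)])
    (fun x => hC _ (inner_mem_Icc x θ))
    (fun x => hasDerivAt_radialPow n r _) ?_ ?_
  · -- The truncation is inactive exactly in the directions of `r⁻¹ • K`.
    have hset : {x : sphere (0 : EuclideanSpace ℝ (Fin n)) 1 |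
        radialPow n r (0, inner ℝ (x : EuclideanSpace ℝ (Fin n)) θ) ≤ (gauge K x)⁻¹ ^ n} =
        (↑) ⁻¹' (r⁻¹ • K) := by
      ext x
      have hg := hgpos x
      rw [mem_ofPred_eq, radialPow_zero, pow_le_pow_iff_left₀ hr.le (by positivity) hn,
        le_inv_comm₀ hr hg, mem_preimage, mem_inv_smul_set_iff₀ hr.ne',
        ← hK.isCompact.isClosed.closure_eq, ← gauge_le_one_iff_mem_closure hK.convex hnhds,
        hgr, ← le_inv_mul_iff₀ hr, mul_one, hK.isCompact.isClosed.closure_eq]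
    rw [hset, integral_const_mul] at key
    have hn' : (n : ℝ) ≠ 0 := Nat.cast_ne_zero.2 hn
    exact (mul_eq_zero.1 key).resolve_left (by positivity)
  · filter_upwards [ae_smul_notMem_frontier hn hr hnull] with x hx heq
    refine hx ?_
    rw [← gauge_eq_one_iff_mem_frontier hK.convex hnhds, hgr]
    rw [radialPow_zero] at heq
    have := (pow_left_inj₀ hr.le (inv_nonneg.2 (hgpos x).le) hn).1 heq
    rw [this, inv_mul_cancel₀ (hgpos x).ne']
  · refine .of_forall fun t => ?_
    have hvol : ∀ s : ℝ, ∫ x : sphere (0 : EuclideanSpace ℝ (Fin n)) 1,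
        min ((gauge K x)⁻¹ ^ n) (radialPow n r (s, inner ℝ (x : EuclideanSpace ℝ (Fin n)) θ))
          ∂surfaceMeasure n = n * volume.real (K ∩ {x | ‖stretch (θ : EuclideanSpace ℝ (Fin n))
            (Real.exp (n * s)) x‖ ≤ r * Real.exp s}) := fun s => by
      rw [volume_inter_stretch_eq hK hr, mul_inv_cancel_left₀ (Nat.cast_ne_zero.2 hn)]
    have hzero : {x | ‖stretch (θ : EuclideanSpace ℝ (Fin n)) (Real.exp (n * 0)) x‖
        ≤ r * Real.exp 0} = closedBall 0 r := by
      ext x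
      simp [stretch_apply]
    simp only [hvol]
    rw [hzero]
    refine mul_le_mul_of_nonneg_left (ENNReal.toReal_mono ?_ (hmax.2 _ ?_ ?_)) (by positivity)
    · exact ((measure_mono inter_subset_left).trans_lt hK.isCompact.measure_lt_top).ne
    · exact isEllipsoid_norm_stretch_le hθ (Real.exp_pos _) (by positivity)
    · refine volume_norm_stretch_le hθ (Real.exp_pos _) (by positivity) ?_
      rw [mul_pow, ← Real.exp_nat_mul, mul_comm]

theorem theorem1p2 {n : ℕ} (K : Set (EuclideanSpace ℝ (Fin n))) (hK : IsSymmConvexBody K)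
    (r : ℝ) (hr : 0 < r)
    (hfin : {ℰ : Set (EuclideanSpace ℝ (Fin n)) |
      IsEllipsoid ℰ ∧ hypersurfaceVol (frontier K ∩ frontier ℰ) ≠ 0}.Finite)
    (hnull : hypersurfaceVol (frontier K ∩ sphere 0 r) = 0)
    (hpos : 0 < hypersurfaceVol (K ∩ sphere 0 r))
    (hmax : InMaxIntersectionPosition K r) :
    IsProbabilityMeasure (normalizedSurfaceMeasure (r⁻¹ • K)) ∧
      IsIsotropic (normalizedSurfaceMeasure (r⁻¹ • K)) := by
  rcases n with _ | m
  · -- In dimension zero the sphere is empty.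
    have hempty : K ∩ sphere 0 r = ∅ := eq_empty_of_forall_notMem fun x hx =>
      ne_of_mem_sphere hx.2 hr.ne' (Subsingleton.elim _ _)
    simp [hempty, hypersurfaceVol] at hpos
  set A : Set (sphere (0 : EuclideanSpace ℝ (Fin (m + 1))) 1) := (↑) ⁻¹' (r⁻¹ • K) with hA
  have hfinite : IsFiniteMeasure (surfaceMeasure (m + 1)) := by
    unfold surfaceMeasure; infer_instance
  have hA0 : surfaceMeasure (m + 1) A ≠ 0 := surfaceMeasure_preimage_ne_zero hr hnull hpos
  have hprob : IsProbabilityMeasure (normalizedSurfaceMeasure (r⁻¹ • K)) := by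
    refine ⟨?_⟩
    rw [normalizedSurfaceMeasure, Measure.smul_apply, Measure.restrict_apply_univ, smul_eq_mul,
      ENNReal.inv_mul_cancel hA0 (measure_ne_top _ _)]
  refine ⟨hprob, inferInstance, fun θ => ?_⟩
  have key := setIntegral_one_sub_inner_sq_eq_zero m.succ_ne_zero hK hr hnull hmax θ
  rw [← hA] at key
  have hint : Integrable (fun x : sphere (0 : EuclideanSpace ℝ (Fin (m + 1))) 1 =>
      inner ℝ (x : EuclideanSpace ℝ (Fin (m + 1))) (θ : EuclideanSpace ℝ (Fin (m + 1))) ^ 2)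
      ((surfaceMeasure (m + 1)).restrict A) := by
    refine Integrable.of_bound (C := 1)
      (by fun_prop : Continuous _).aestronglyMeasurable (.of_forall fun x => ?_)
    rw [norm_pow, Real.norm_eq_abs]
    exact pow_le_one₀ (abs_nonneg _) (abs_le.2 (inner_mem_Icc x θ))
  rw [integral_sub (integrable_const _) (hint.const_mul _), integral_const_mul,
    setIntegral_const, smul_eq_mul, mul_one, sub_eq_zero] at key
  have hA1 : (surfaceMeasure (m + 1)).real A ≠ 0 :=
    (ENNReal.toReal_pos hA0 (measure_ne_top _ _)).ne'
  rw [probReal_univ, normalizedSurfaceMeasure, integral_smul_measure, ← hA, ENNReal.toReal_inv,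
    ← measureReal_def, smul_eq_mul, inv_mul_eq_div, div_eq_div_iff hA1 (by positivity), one_mul,
    key, mul_comm]
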